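/- Let $(X_n)_{n\in\mathbb Z}$ be a zero-mean, real-valued, wide sense stationary sequence of random variables with finite second moments on a probability space, with covariance sequence $R_k=\mathbb E[X_{n+k}X_n]$ and $\sum_{k\in\mathbb Z}|R_k|<\infty$. Assume that its spectral density $S(\lambda)=\sum_{k\in\mathbb Z}R_k e^{-2\pi i\lambda k}$ satisfies $S(\lambda)>0$ for all $\lambda\in(-\frac12,\frac12]$. Let $H_{n-1}$ be the closed linear span of $X_{n-1},X_{n-2},\dots$ in $L^2(\mathbb P)$ and, for $p\ge 1$, let $H_{n-1}^p$ be the linear span of $X_{n-1},\dots,X_{n-p}$. Then there are real numbers $b_k$ ($k\ge1$), and for each $p\ge1$ real numbers $b_{1,p},\dots,b_{p,p}$, such that for every $n\in\mathbb Z$ the orthogonal projections of $X_n$ onto $H_{n-1}$ and onto $H_{n-1}^p$ are, respectively, $\sum_{k=1}^\infty b_kX_{n-k}$ (with convergence of the partial sums in $L^2$) and $\sum_{k=1}^p b_{k,p}X_{n-k}$; and for all such numbers $$\lim_{p\to\infty}\sum_{k=1}^p|b_{k,p}-b_k|=0 .$$ -/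

import Mathlib

open MeasureTheory Filter Topology

noncomputable section

namespace ARApprox

variable {Ω : Type*} [MeasurableSpace Ω]

/-- A zero-mean real-valued wide sense stationary sequence `(X n)`, `n ∈ ℤ`, with finite second
moments: `E[X (n + k) X n]` does not depend on `n`. -/
structure IsWSS (X : ℤ → Ω → ℝ) (P : Measure Ω) : Prop where
  memLp : ∀ n, MemLp (X n) 2 P
  mean_zero : ∀ n, ∫ ω, X n ω ∂P = 0
  stationary : ∀ n k : ℤ, ∫ ω, X (n + k) ω * X n ω ∂P = ∫ ω, X k ω * X 0 ω ∂P

/-- The covariance sequence `R k = E[X k X 0]`, which is `E[X (n + k) X n]` for every `n` when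
the sequence is wide sense stationary. -/
def autocov (X : ℤ → Ω → ℝ) (P : Measure Ω) (k : ℤ) : ℝ :=
  ∫ ω, X k ω * X 0 ω ∂P

/-- The Fourier transform `S(l) = ∑ R k e^{-2 π i l k}`, the sum over all integers `k`. -/
def spectralDensity (R : ℤ → ℝ) (l : ℝ) : ℂ :=
  ∑' k : ℤ, (R k : ℂ) * Complex.exp (-2 * Real.pi * Complex.I * l * k)

variable {X : ℤ → Ω → ℝ} {P : Measure Ω}

/-- `X n` as an element of the Hilbert space `L²(P)`. -/
def IsWSS.toL2 (hX : IsWSS X P) (n : ℤ) : Lp ℝ 2 P :=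
  (hX.memLp n).toLp (X n)

/-- `H_n`: the closed linear span in `L²(P)` of `X n, X (n - 1), X (n - 2), …`. -/
def IsWSS.past (hX : IsWSS X P) (n : ℤ) : Submodule ℝ (Lp ℝ 2 P) :=
  (Submodule.span ℝ (hX.toL2 '' {m : ℤ | m ≤ n})).topologicalClosure

/-- `H_n^p`: the closed linear span in `L²(P)` of `X n, X (n - 1), …, X (n - p + 1)`. -/
def IsWSS.finitePast (hX : IsWSS X P) (n : ℤ) (p : ℕ) : Submodule ℝ (Lp ℝ 2 P) :=
  (Submodule.span ℝ (hX.toL2 '' {m : ℤ | n - p + 1 ≤ m ∧ m ≤ n})).topologicalClosure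

instance (hX : IsWSS X P) (n : ℤ) : (hX.past n).HasOrthogonalProjection := by
  unfold IsWSS.past; infer_instance

instance (hX : IsWSS X P) (n : ℤ) (p : ℕ) : (hX.finitePast n p).HasOrthogonalProjection := by
  unfold IsWSS.finitePast; infer_instance

/-- `b 1, b 2, …` are infinite-order autoregressive coefficients: for every `n`, the orthogonal
projection of `X n` onto `H_{n-1}` is the sum of the `L²`-convergent series
`∑ b k X (n - k)` over `k ≥ 1`. The value `b 0` plays no role. -/
def IsWSS.IsARCoeff (hX : IsWSS X P) (b : ℕ → ℝ) : Prop :=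
  ∀ n : ℤ, Tendsto (fun N : ℕ => ∑ k ∈ Finset.Icc 1 N, b k • hX.toL2 (n - k)) atTop
    (𝓝 ((hX.past (n - 1)).starProjection (hX.toL2 n)))

/-- `c 1, …, c p` are autoregressive coefficients of order `p`: for every `n`, the orthogonal
projection of `X n` onto `H_{n-1}^p` is `c 1 X (n - 1) + … + c p X (n - p)`. The other values
of `c` play no role. -/
def IsWSS.IsFiniteARCoeff (hX : IsWSS X P) (p : ℕ) (c : ℕ → ℝ) : Prop :=
  ∀ n : ℤ, (hX.finitePast (n - 1) p).starProjection (hX.toL2 n) =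
    ∑ k ∈ Finset.Icc 1 p, c k • hX.toL2 (n - k)

end ARApprox

end

/-! Both kinds of coefficients solve normal equations: with `T` the Toeplitz matrix of `R`, the
order-`p` ones solve the section of `T` on `[1, p]`, the infinite ones the whole half-line system.
Subtracting, the section applied to `b_{·,p} - b` equals the contribution of the tail of `b`. If the
sections are invertible in `ℓ¹` uniformly in `p`, Baxter's inequality bounds the error by a constant
times `∑_{k>p} |b_k|`, which tends to zero.

Uniform stability (`exists_sum_abs_le_toeplitz_int`) combines two facts. Wiener's lemma makes
convolution by `R` on `ℤ` bounded below in `ℓ¹`; a positive minimum of `S` makes the sections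
coercive in `ℓ²`, which controls the largest entry. Convolving a sequence on `[1, p]` leaks mass
past the endpoints: short shifts leak a bounded number of entries, and long shifts carry little
weight, so their leak is absorbed.

A summable `b` comes from the same bound: the finite coefficients are bounded in `ℓ¹` and converge
uniformly, because projections onto increasing subspaces converge. -/

open scoped BoundedContinuousFunction

noncomputable section

namespace ARApprox

/-! ### Wiener's lemma and the `ℓ¹` lower bound for convolution on `ℤ` -/

section Wiener

/-- Wiener's lemma in a commutative Banach algebra generated by a doubly power bounded unit. -/
theorem isUnit_tsum_smul_zpow_of_comm {A : Type*} [NormedCommRing A] [NormedAlgebra ℂ A]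
    [CompleteSpace A] (u : Aˣ) {K : ℝ} (hu : ∀ k : ℤ, ‖((u ^ k : Aˣ) : A)‖ ≤ K)
    {r : ℤ → ℂ} (hr : Summable fun k => ‖r k‖)
    (hs : ∀ z : ℂ, ‖z‖ = 1 → ∑' k : ℤ, r k * z ^ k ≠ 0) :
    IsUnit (∑' k : ℤ, r k • ((u ^ k : Aˣ) : A)) := by
  by_contra hcon
  obtain ⟨φ, hφ⟩ := WeakDual.CharacterSpace.exists_apply_eq_zero hcon
  have hsum : Summable fun k : ℤ => r k • ((u ^ k : Aˣ) : A) := by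
    refine Summable.of_norm_bounded (hr.mul_right K) fun k => ?_
    rw [norm_smul]
    exact mul_le_mul_of_nonneg_left (hu k) (norm_nonneg _)
  set ψ : A →ₐ[ℂ] ℂ := WeakDual.CharacterSpace.toAlgHom φ with hψ
  have hpow : ∀ k : ℤ, ψ ((u ^ k : Aˣ) : A) = (ψ (u : A)) ^ k := fun k => by
    have h := congrArg Units.val (map_zpow (Units.map (ψ : A →* ℂ)) u k)
    rw [Units.val_zpow_eq_zpow_val] at h
    exact h
  have hne : ψ (u : A) ≠ 0 := (u.isUnit.map ψ).ne_zero
  have hbd : ∀ k : ℤ, ‖ψ (u : A)‖ ^ k ≤ K * ‖(1 : A)‖ := fun k => by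
    rw [← norm_zpow, ← hpow]
    exact (AlgHom.norm_apply_le_self_mul_norm_one ψ _).trans
      (mul_le_mul_of_nonneg_right (hu k) (norm_nonneg _))
  -- All integer powers of `ψ u` are bounded, so it lies on the unit circle, where the symbol does
  -- not vanish.
  have hnorm : ‖ψ (u : A)‖ = 1 := by
    have hp : 0 < ‖ψ (u : A)‖ := norm_pos_iff.2 hne
    rcases lt_trichotomy ‖ψ (u : A)‖ 1 with h | h | h
    · obtain ⟨n, hn⟩ := pow_unbounded_of_one_lt (K * ‖(1 : A)‖) ((one_lt_inv₀ hp).2 h)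
      have := hbd (-n)
      rw [zpow_neg, zpow_natCast, ← inv_pow] at this
      linarith
    · exact h
    · obtain ⟨n, hn⟩ := pow_unbounded_of_one_lt (K * ‖(1 : A)‖) h
      have := hbd n
      rw [zpow_natCast] at this
      linarith
  refine hs _ hnorm ?_
  have h1 : HasSum (fun k : ℤ => φ (r k • ((u ^ k : Aˣ) : A))) (φ (∑' k, r k • ((u ^ k : Aˣ) : A))) :=
    hsum.hasSum.map φ (map_continuous φ)
  rw [hφ] at h1
  rw [← h1.tsum_eq]
  refine tsum_congr fun k => ?_
  rw [← hpow k, map_smul, smul_eq_mul]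
  rfl

/-- Wiener's lemma for the closed subalgebra generated by a power bounded unit of a Banach
algebra. -/
theorem isUnit_tsum_smul_zpow {A : Type*} [NormedRing A] [NormedAlgebra ℂ A]
    [CompleteSpace A] (u : Aˣ) {K : ℝ} (hu : ∀ k : ℤ, ‖((u ^ k : Aˣ) : A)‖ ≤ K)
    {r : ℤ → ℂ} (hr : Summable fun k => ‖r k‖)
    (hs : ∀ z : ℂ, ‖z‖ = 1 → ∑' k : ℤ, r k * z ^ k ≠ 0) :
    IsUnit (∑' k : ℤ, r k • ((u ^ k : Aˣ) : A)) := by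
  -- The double centralizer of `u` is closed, contains every integer power of `u`, and is
  -- commutative since `u` lies in its own centralizer.
  set B : Subalgebra ℂ A :=
    Subalgebra.centralizer ℂ (Subalgebra.centralizer ℂ {(u : A)} : Set A) with hB
  have hmem : ∀ k : ℤ, ((u ^ k : Aˣ) : A) ∈ B := fun k => by
    rw [hB, Subalgebra.mem_centralizer_iff]
    intro g hg
    have hg' : (u : A) * g = g * u := (Subalgebra.mem_centralizer_iff ℂ).1 hg _ rfl
    have hc : Commute g (u : A) := hg'.symm
    exact hc.units_zpow_right k
  have hcomm : ∀ x y : B, x * y = y * x := fun x y => by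
    refine Subtype.ext ?_
    have hx := (Subalgebra.mem_centralizer_iff ℂ).1 x.2
    refine (hx y ?_).symm
    rw [SetLike.mem_coe, Subalgebra.mem_centralizer_iff]
    rintro _ rfl
    refine (Subalgebra.mem_centralizer_iff ℂ).1 y.2 u ?_
    rw [SetLike.mem_coe, Subalgebra.mem_centralizer_iff]
    rintro _ rfl
    rfl
  have hclosed : IsClosed (B : Set A) := by
    rw [hB, Subalgebra.coe_centralizer]
    exact Set.isClosed_centralizer _
  have : CompleteSpace B := hclosed.completeSpace_coe
  let _ : NormedCommRing B := { (inferInstance : NormedRing B) with mul_comm := hcomm }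
  let v : Bˣ :=
    ⟨⟨u, by simpa using hmem 1⟩, ⟨((u⁻¹ : Aˣ) : A), by simpa using hmem (-1)⟩,
      Subtype.ext u.mul_inv, Subtype.ext u.inv_mul⟩
  have hv : ∀ k : ℤ, (((v ^ k : Bˣ) : B) : A) = ((u ^ k : Aˣ) : A) := fun k => by
    have h := congrArg Units.val (map_zpow (Units.map (B.val : B →* A)) v k)
    have h2 : Units.map (B.val : B →* A) v = u := Units.ext rfl
    rw [h2] at h
    exact h
  have hnv : ∀ k : ℤ, ‖((v ^ k : Bˣ) : B)‖ ≤ K := fun k => by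
    have : ‖((v ^ k : Bˣ) : B)‖ = ‖(((v ^ k : Bˣ) : B) : A)‖ := rfl
    rw [this, hv]
    exact hu k
  have key := isUnit_tsum_smul_zpow_of_comm v hnv hr hs
  have hsum : Summable fun k : ℤ => r k • ((v ^ k : Bˣ) : B) := by
    refine Summable.of_norm_bounded (hr.mul_right K) fun k => ?_
    rw [norm_smul]
    exact mul_le_mul_of_nonneg_left (hnv k) (norm_nonneg _)
  have h1 := hsum.hasSum.map B.val continuous_subtype_val
  have h2 := key.map B.val
  rw [← h1.tsum_eq] at h2
  refine (congrArg IsUnit (tsum_congr fun k => ?_)).mp h2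
  simp [hv]

/-- The shift `w ↦ w (· + m)` on bounded sequences. -/
def shiftCLM (m : ℤ) : (ℤ →ᵇ ℂ) →L[ℂ] (ℤ →ᵇ ℂ) :=
  LinearMap.mkContinuous
    { toFun := fun w => w.compContinuous ⟨fun j => j + m, continuous_of_discreteTopology⟩
      map_add' := fun _ _ => rfl
      map_smul' := fun _ _ => rfl } 1
    fun w => by
      rw [one_mul]
      exact (BoundedContinuousFunction.norm_le (norm_nonneg _)).2 fun j => w.norm_coe_le_norm _

theorem shiftCLM_apply (m : ℤ) (w : ℤ →ᵇ ℂ) (j : ℤ) : shiftCLM m w j = w (j + m) := rfl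

theorem norm_shiftCLM_le (m : ℤ) : ‖shiftCLM m‖ ≤ 1 :=
  LinearMap.mkContinuous_norm_le _ zero_le_one _

/-- The shifts as a homomorphism into the units of the bounded operators. -/
def shiftUnits : Multiplicative ℤ →* ((ℤ →ᵇ ℂ) →L[ℂ] (ℤ →ᵇ ℂ))ˣ :=
  MonoidHom.toHomUnits
    { toFun := fun m => shiftCLM m.toAdd
      map_one' := by ext w j; simp [shiftCLM_apply]
      map_mul' := fun m n => by
        ext w j
        simp only [toAdd_mul, mul_apply_eq_comp, shiftCLM_apply]
        congr 1; ring }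

theorem coe_shiftUnits_zpow (k : ℤ) :
    ((shiftUnits (Multiplicative.ofAdd 1) ^ k : ((ℤ →ᵇ ℂ) →L[ℂ] (ℤ →ᵇ ℂ))ˣ) :
      (ℤ →ᵇ ℂ) →L[ℂ] (ℤ →ᵇ ℂ)) = shiftCLM k := by
  rw [← map_zpow, ← ofAdd_zsmul]
  simp [shiftUnits]

/-- A summable real sequence with nonvanishing symbol defines a convolution operator which is
bounded below on finitely supported sequences in the `ℓ¹` norm. -/
theorem exists_sum_abs_le_tsum_abs_conv {R : ℤ → ℝ} (hR : Summable fun k => |R k|)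
    (hs : ∀ z : ℂ, ‖z‖ = 1 → ∑' k : ℤ, (R k : ℂ) * z ^ k ≠ 0) :
    ∃ G : ℝ, 0 < G ∧ ∀ (s : Finset ℤ) (a : ℤ → ℝ),
      ∑ k ∈ s, |a k| ≤ G * ∑' j : ℤ, |∑ k ∈ s, R (j - k) * a k| := by
  have hr : Summable fun k : ℤ => ‖(R k : ℂ)‖ := by simpa using hR
  have hunit := isUnit_tsum_smul_zpow (A := (ℤ →ᵇ ℂ) →L[ℂ] (ℤ →ᵇ ℂ))
    (shiftUnits (Multiplicative.ofAdd 1)) (K := 1)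
    (fun k => by rw [coe_shiftUnits_zpow]; exact norm_shiftCLM_le k) hr hs
  simp only [coe_shiftUnits_zpow] at hunit
  have hsum : Summable fun k : ℤ => (R k : ℂ) • shiftCLM k := by
    refine Summable.of_norm_bounded hr fun k => ?_
    rw [norm_smul]
    exact mul_le_of_le_one_right (norm_nonneg _) (norm_shiftCLM_le k)
  set T := ∑' k : ℤ, (R k : ℂ) • shiftCLM k with hT
  obtain ⟨V, hV⟩ := hunit.exists_right_inv
  -- `T` on `ℓ^∞` is the transpose of convolution by `R` on `ℓ¹`; surjectivity of `T` yields the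
  -- lower bound by duality.
  have hTapply : ∀ (w : ℤ →ᵇ ℂ) (i : ℤ), HasSum (fun j : ℤ => (R (j - i) : ℂ) * w j) (T w i) := by
    intro w i
    have h1 : HasSum (fun k : ℤ => (R k : ℂ) * w (i + k)) (T w i) :=
      (hsum.hasSum.mapL (ContinuousLinearMap.apply ℂ _ w)).mapL
        (BoundedContinuousFunction.evalCLM ℂ i)
    rw [← (Equiv.subRight i).hasSum_iff] at h1
    have h2 : (fun k : ℤ => (R k : ℂ) * w (i + k)) ∘ ⇑(Equiv.subRight i) =
        fun j : ℤ => (R (j - i) : ℂ) * w j := by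
      ext j
      simp
    rwa [h2] at h1
  refine ⟨‖V‖ + 1, by positivity, fun s a => ?_⟩
  have hconv : Summable fun j : ℤ => |∑ k ∈ s, R (j - k) * a k| := by
    refine Summable.of_nonneg_of_le (fun _ => abs_nonneg _)
      (fun j => Finset.abs_sum_le_sum_abs _ _) (summable_sum fun k _ => ?_)
    simp_rw [abs_mul]
    exact ((Equiv.subRight k).summable_iff.2 hR).mul_right _
  -- Pairing `a` with its sign sequence gives its `ℓ¹` norm. Solving `T w = e` moves the pairing
  -- onto `R * a`, at the cost of `‖w‖ ≤ ‖V‖ + 1`.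
  let e : ℤ →ᵇ ℂ := BoundedContinuousFunction.ofNormedAddCommGroupDiscrete
    (fun k => ((SignType.sign (a k) : ℝ) : ℂ)) 1 fun k => by
      rcases lt_trichotomy (a k) 0 with h | h | h <;> simp [h]
  have he : ‖e‖ ≤ 1 := BoundedContinuousFunction.norm_ofNormedAddCommGroup_le _ zero_le_one _
  set w := V e with hw
  have hTw : T w = e := by rw [hw, ← mul_apply_eq_comp, hV]; rfl
  have hwn : ‖w‖ ≤ ‖V‖ + 1 := by
    refine (V.le_opNorm e).trans ?_
    nlinarith [norm_nonneg V]
  have h1 : HasSum (fun j : ℤ => ∑ k ∈ s, (a k : ℂ) * ((R (j - k) : ℂ) * w j))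
      (∑ k ∈ s, (a k : ℂ) * e k) := by
    refine hasSum_sum fun k _ => ?_
    rw [← hTw]
    exact (hTapply w k).mul_left _
  have h2 : ∑ k ∈ s, (a k : ℂ) * e k = ((∑ k ∈ s, |a k| : ℝ) : ℂ) := by
    push_cast
    refine Finset.sum_congr rfl fun k _ => ?_
    have : e k = ((SignType.sign (a k) : ℝ) : ℂ) := rfl
    rw [this, ← Complex.ofReal_mul, mul_comm, sign_mul_self]
  have h3 : ∀ j : ℤ, ‖∑ k ∈ s, (a k : ℂ) * ((R (j - k) : ℂ) * w j)‖ ≤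
      (‖V‖ + 1) * |∑ k ∈ s, R (j - k) * a k| := fun j => by
    have : ∑ k ∈ s, (a k : ℂ) * ((R (j - k) : ℂ) * w j) =
        w j * ((∑ k ∈ s, R (j - k) * a k : ℝ) : ℂ) := by
      push_cast
      rw [Finset.mul_sum]
      exact Finset.sum_congr rfl fun k _ => by ring
    rw [this, norm_mul, Complex.norm_real, Real.norm_eq_abs]
    exact mul_le_mul_of_nonneg_right ((w.norm_coe_le_norm j).trans hwn) (abs_nonneg _)
  have h4 := tsum_of_norm_bounded (hconv.hasSum.mul_left (‖V‖ + 1)) h3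
  rw [h1.tsum_eq, h2, Complex.norm_real, Real.norm_eq_abs] at h4
  exact (le_abs_self _).trans h4

end Wiener

/-! ### Coercivity of the Toeplitz form -/

section LowerBound

/-- Integration over the unit circle, as a continuous functional. -/
def circleIntegral : C(AddCircle (1 : ℝ), ℂ) →L[ℂ] ℂ :=
  LinearMap.mkContinuous
    { toFun := fun g => ∫ t, g t ∂(AddCircle.haarAddCircle (T := (1 : ℝ)))
      map_add' := fun g h => integral_add (g.continuous.integrable_of_hasCompactSupport
        (HasCompactSupport.of_compactSpace _)) (h.continuous.integrable_of_hasCompactSupport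
        (HasCompactSupport.of_compactSpace _))
      map_smul' := fun c g => integral_const_mul c _ } 1
    fun g => by
      have := norm_integral_le_of_norm_le_const (μ := AddCircle.haarAddCircle (T := (1 : ℝ)))
        (Eventually.of_forall g.norm_coe_le_norm)
      simpa using this

theorem circleIntegral_apply (g : C(AddCircle (1 : ℝ), ℂ)) :
    circleIntegral g = ∫ t, g t ∂(AddCircle.haarAddCircle (T := (1 : ℝ))) := rfl

theorem circleIntegral_fourier (n : ℤ) : circleIntegral (fourier n) = if n = 0 then 1 else 0 := by
  rw [circleIntegral_apply]
  split_ifs with h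
  · subst h
    simp
  · exact integral_eq_zero_of_add_right_eq_neg (fourier_add_half_inv_index h one_pos)

theorem re_circleIntegral_nonneg {g : C(AddCircle (1 : ℝ), ℂ)} (hg : ∀ t, 0 ≤ (g t).re) :
    0 ≤ (circleIntegral g).re := by
  have hi : Integrable g (AddCircle.haarAddCircle (T := (1 : ℝ))) :=
    g.continuous.integrable_of_hasCompactSupport (HasCompactSupport.of_compactSpace _)
  have h := integral_re hi
  rw [circleIntegral_apply]
  exact (integral_nonneg hg).trans_eq h

theorem fourier_mul_fourier (m n : ℤ) :
    (fourier m * fourier n : C(AddCircle (1 : ℝ), ℂ)) = fourier (m + n) := by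
  ext t
  exact fourier_add.symm

/-- The symbol of a summable sequence as a continuous function on the circle. -/
def symbol (R : ℤ → ℝ) : C(AddCircle (1 : ℝ), ℂ) := ∑' k : ℤ, (R k : ℂ) • fourier (-k)

theorem hasSum_symbol {R : ℤ → ℝ} (hR : Summable fun k => |R k|) :
    HasSum (fun k : ℤ => (R k : ℂ) • (fourier (-k) : C(AddCircle (1 : ℝ), ℂ))) (symbol R) := by
  refine (Summable.of_norm_bounded hR fun k => ?_).hasSum
  rw [norm_smul, fourier_norm, mul_one, Complex.norm_real, Real.norm_eq_abs]

theorem symbol_coe {R : ℤ → ℝ} (hR : Summable fun k => |R k|) (l : ℝ) :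
    symbol R (l : AddCircle (1 : ℝ)) = spectralDensity R l := by
  have h := (hasSum_symbol hR).mapL (ContinuousMap.evalCLM ℂ (l : AddCircle (1 : ℝ)))
  refine h.tsum_eq.symm.trans (tsum_congr fun k => ?_)
  simp only [map_smul, ContinuousMap.evalCLM_apply, smul_eq_mul, fourier_coe_apply]
  congr 2
  push_cast
  ring

theorem circleIntegral_symbol_mul_fourier {R : ℤ → ℝ} (hR : Summable fun k => |R k|) (n : ℤ) :
    circleIntegral (symbol R * fourier n) = R n := by
  have h := ((hasSum_symbol hR).mul_right (fourier n)).mapL circleIntegral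
  rw [← h.tsum_eq, tsum_eq_single n]
  · rw [smul_mul_assoc, fourier_mul_fourier, map_smul, circleIntegral_fourier]
    simp
  · intro k hk
    rw [smul_mul_assoc, fourier_mul_fourier, map_smul, circleIntegral_fourier, if_neg, smul_zero]
    omega

/-- If the symbol is positive, the Toeplitz form is bounded below. -/
theorem exists_le_toeplitz_form {R : ℤ → ℝ} (hR : Summable fun k => |R k|)
    (hpos : ∀ l ∈ Set.Ioc (-(1 / 2) : ℝ) (1 / 2), 0 < (spectralDensity R l).re) :
    ∃ c : ℝ, 0 < c ∧ ∀ (s : Finset ℤ) (a : ℤ → ℝ),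
      c * ∑ k ∈ s, a k ^ 2 ≤ ∑ j ∈ s, ∑ k ∈ s, a j * a k * R (j - k) := by
  have hpos' : ∀ t : AddCircle (1 : ℝ), 0 < (symbol R t).re := fun t => by
    obtain ⟨l, hl, rfl⟩ := AddCircle.coe_image_Ioc_eq (1 : ℝ) (-(1 / 2)) ▸ Set.mem_univ t
    rw [symbol_coe hR]
    exact hpos l ⟨hl.1, by linarith [hl.2]⟩
  obtain ⟨t₀, -, ht₀⟩ := isCompact_univ.exists_isMinOn (Set.univ_nonempty)
    (Complex.continuous_re.comp (symbol R).continuous).continuousOn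
  refine ⟨(symbol R t₀).re, hpos' t₀, fun s a => ?_⟩
  set c := (symbol R t₀).re with hc
  set A : C(AddCircle (1 : ℝ), ℂ) := ∑ j ∈ s, (a j : ℂ) • fourier j with hA
  set A' : C(AddCircle (1 : ℝ), ℂ) := ∑ j ∈ s, (a j : ℂ) • fourier (-j) with hA'
  have hAA : ∀ t, A' t = starRingEnd ℂ (A t) := fun t => by
    simp only [hA, hA', ContinuousMap.sum_apply, ContinuousMap.smul_apply, smul_eq_mul, map_sum,
      map_mul, Complex.conj_ofReal, fourier_neg]
  -- Here `A * A'` is `|A|²` and `c` is the minimum of the real part of the symbol.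
  have hnn : 0 ≤ (circleIntegral ((symbol R - (c : ℂ) • 1) * (A * A'))).re := by
    refine re_circleIntegral_nonneg fun t => ?_
    simp only [ContinuousMap.mul_apply, ContinuousMap.sub_apply, ContinuousMap.smul_apply,
      ContinuousMap.one_apply, hAA, Complex.mul_conj]
    rw [Complex.re_mul_ofReal]
    refine mul_nonneg ?_ (Complex.normSq_nonneg _)
    have := ht₀ (Set.mem_univ t)
    simpa [hc] using this
  have hI : ∀ n : ℤ, circleIntegral ((symbol R - (c : ℂ) • 1) * fourier n) =
      ((R n - c * if n = 0 then 1 else 0 : ℝ) : ℂ) := fun n => by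
    rw [sub_mul, map_sub, circleIntegral_symbol_mul_fourier hR, smul_mul_assoc, one_mul, map_smul,
      circleIntegral_fourier, smul_eq_mul]
    push_cast
    split_ifs <;> simp
  have hexp : circleIntegral ((symbol R - (c : ℂ) • 1) * (A * A')) =
      ((∑ j ∈ s, ∑ k ∈ s, a j * a k * (R (j - k) - c * if j - k = 0 then 1 else 0) : ℝ) : ℂ) := by
    rw [hA, hA', Finset.sum_mul_sum, Finset.mul_sum, map_sum]
    push_cast
    refine Finset.sum_congr rfl fun j _ => ?_
    rw [Finset.mul_sum, map_sum]
    refine Finset.sum_congr rfl fun k _ => ?_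
    rw [smul_mul_smul_comm, fourier_mul_fourier, mul_smul_comm, map_smul, ← sub_eq_add_neg, hI]
    push_cast
    rfl
  rw [hexp, Complex.ofReal_re] at hnn
  have hdiag : ∑ j ∈ s, ∑ k ∈ s, a j * a k * (R (j - k) - c * if j - k = 0 then 1 else 0) =
      ∑ j ∈ s, ∑ k ∈ s, a j * a k * R (j - k) - c * ∑ k ∈ s, a k ^ 2 := by
    rw [Finset.mul_sum, ← Finset.sum_sub_distrib]
    refine Finset.sum_congr rfl fun j hj => ?_
    simp only [mul_sub, Finset.sum_sub_distrib]
    congr 1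
    rw [Finset.sum_eq_single j]
    · simp; ring
    · intro k _ hk
      rw [if_neg (by omega)]; ring
    · exact fun h => absurd hj h
  linarith

/-- A positive spectral density does not vanish anywhere on the circle. -/
theorem tsum_mul_zpow_ne_zero {R : ℤ → ℝ}
    (hpos : ∀ l ∈ Set.Ioc (-(1 / 2) : ℝ) (1 / 2), 0 < (spectralDensity R l).re)
    (z : ℂ) (hz : ‖z‖ = 1) : ∑' k : ℤ, (R k : ℂ) * z ^ k ≠ 0 := by
  have hπ := Real.pi_pos
  -- The density at frequency `l` is the series at `z = e^{-2πil}`, hence the inverse; the range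
  -- `(-π, π]` of `arg` matches the half-open interval.
  set θ := Complex.arg z⁻¹ with hθ
  have h := hpos (θ / (2 * Real.pi)) ⟨by
    rw [lt_div_iff₀ (by positivity)]; linarith [Complex.neg_pi_lt_arg z⁻¹], by
    rw [div_le_iff₀ (by positivity)]; linarith [Complex.arg_le_pi z⁻¹]⟩
  have hz' : Complex.exp (θ * Complex.I) = z⁻¹ := by
    have := Complex.norm_mul_exp_arg_mul_I z⁻¹
    rwa [norm_inv, hz, inv_one, Complex.ofReal_one, one_mul] at this
  have heq : spectralDensity R (θ / (2 * Real.pi)) = ∑' k : ℤ, (R k : ℂ) * z ^ k := by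
    refine tsum_congr fun k => ?_
    congr 1
    rw [← inv_inv z, ← hz', inv_zpow', ← Complex.exp_int_mul]
    congr 1
    push_cast
    field_simp
  rw [← heq]
  intro h0
  rw [h0] at h
  exact lt_irrefl _ h

end LowerBound

/-! ### Uniform `ℓ¹` stability of the finite sections -/

section Stability

/-- A translation by `i` pushes at most `|i|` integer points out of an interval, whatever its
length. -/
theorem sum_abs_shift_escape_le (p : ℕ) (a : ℤ → ℝ) {M : ℝ} (hM : 0 ≤ M)
    (ha : ∀ k ∈ Finset.Icc (1 : ℤ) p, |a k| ≤ M) (i : ℤ) :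
    ∑ k ∈ Finset.Icc (1 : ℤ) p, (if i + k ∈ Finset.Icc (1 : ℤ) p then 0 else |a k|) ≤ |(i : ℝ)| * M := by
  have h1 : ∑ k ∈ Finset.Icc (1 : ℤ) p, (if i + k ∈ Finset.Icc (1 : ℤ) p then 0 else |a k|) =
      ∑ k ∈ (Finset.Icc (1 : ℤ) p).filter (fun k => ¬ i + k ∈ Finset.Icc (1 : ℤ) p), |a k| := by
    rw [Finset.sum_filter]
    exact Finset.sum_congr rfl fun k _ => by split_ifs <;> rfl
  have h2 : ((Finset.Icc (1 : ℤ) p).filter (fun k => ¬ i + k ∈ Finset.Icc (1 : ℤ) p)).card ≤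
      i.natAbs := by
    rcases le_total 0 i with h | h
    · refine (Finset.card_le_card (t := Finset.Icc ((p : ℤ) - i + 1) p) fun k hk => ?_).trans ?_
      · simp only [Finset.mem_filter, Finset.mem_Icc] at hk ⊢
        omega
      · rw [Int.card_Icc]; omega
    · refine (Finset.card_le_card (t := Finset.Icc (1 : ℤ) (-i)) fun k hk => ?_).trans ?_
      · simp only [Finset.mem_filter, Finset.mem_Icc] at hk ⊢
        omega
      · rw [Int.card_Icc]; omega
  rw [h1]
  refine (Finset.sum_le_card_nsmul _ _ M fun k hk => ha k (Finset.mem_filter.1 hk).1).trans ?_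
  rw [nsmul_eq_mul]
  refine mul_le_mul_of_nonneg_right ?_ hM
  rw [← Int.cast_abs, Int.abs_eq_natAbs, Int.cast_natCast]
  exact_mod_cast h2

/-- The mass that a convolution moves out of the interval `[1, p]`. -/
theorem tsum_escape_le {R : ℤ → ℝ} (hR : Summable fun k => |R k|) (p : ℕ) (a : ℤ → ℝ) {M : ℝ}
    (hM : 0 ≤ M) (ha : ∀ k ∈ Finset.Icc (1 : ℤ) p, |a k| ≤ M) (F : Finset ℤ) :
    ∑' j : ℤ, |∑ k ∈ Finset.Icc (1 : ℤ) p, R (j - k) * a k| ≤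
      ∑ j ∈ Finset.Icc (1 : ℤ) p, |∑ k ∈ Finset.Icc (1 : ℤ) p, R (j - k) * a k| +
      ((∑ i ∈ F, |R i| * |(i : ℝ)|) * M +
        (∑' i, |R i| - ∑ i ∈ F, |R i|) * ∑ k ∈ Finset.Icc (1 : ℤ) p, |a k|) := by
  set s := Finset.Icc (1 : ℤ) p with hs
  set N := ∑ k ∈ s, |a k| with hN
  have hite : ∀ (S : Finset ℤ) (f : ℤ → ℝ),
      HasSum (fun j => if j ∈ S then f j else 0) (∑ j ∈ S, f j) := fun S f => by
    have h : HasSum (fun j => if j ∈ S then f j else 0) (∑ j ∈ S, if j ∈ S then f j else 0) :=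
      hasSum_sum_of_ne_finset_zero fun j hj => if_neg hj
    rwa [Finset.sum_congr rfl fun j hj => if_pos hj] at h
  have hmaj : Summable fun i : ℤ => ∑ k ∈ s, |R i| * (if i + k ∈ s then 0 else |a k|) := by
    refine summable_sum fun k _ => Summable.of_nonneg_of_le (fun i => ?_) (fun i => ?_)
      (hR.mul_right |a k|)
    · split_ifs <;> positivity
    · refine mul_le_mul_of_nonneg_left ?_ (abs_nonneg _)
      split_ifs
      · exact abs_nonneg _
      · exact le_rfl
  have hout : HasSum (fun j : ℤ => ∑ k ∈ s, |R (j - k)| * (if j ∈ s then 0 else |a k|))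
      (∑' i : ℤ, ∑ k ∈ s, |R i| * (if i + k ∈ s then 0 else |a k|)) := by
    have hk : ∀ k ∈ s, Summable fun i : ℤ => |R i| * (if i + k ∈ s then 0 else |a k|) :=
      fun k _ => by
        refine Summable.of_nonneg_of_le (fun i => ?_) (fun i => ?_) (hR.mul_right |a k|)
        · split_ifs <;> positivity
        · refine mul_le_mul_of_nonneg_left ?_ (abs_nonneg _)
          split_ifs
          · exact abs_nonneg _
          · exact le_rfl
    rw [Summable.tsum_finsetSum hk]
    refine hasSum_sum fun k hks => ?_
    have h := (Equiv.subRight k).hasSum_iff.2 (hk k hks).hasSum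
    have h2 : (fun i : ℤ => |R i| * (if i + k ∈ s then 0 else |a k|)) ∘ ⇑(Equiv.subRight k) =
        fun j : ℤ => |R (j - k)| * (if j ∈ s then 0 else |a k|) := by
      ext j
      simp
    rwa [h2] at h
  -- Shifts in `F` are charged by the number of escaping points; for the others the whole mass `N`
  -- is allowed to escape.
  have hbound : ∑' i : ℤ, ∑ k ∈ s, |R i| * (if i + k ∈ s then 0 else |a k|) ≤
      (∑ i ∈ F, |R i| * |(i : ℝ)|) * M + (∑' i, |R i| - ∑ i ∈ F, |R i|) * N := by
    refine hasSum_le (fun i => ?_) hmaj.hasSum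
      (((hite F fun i => |R i| * |(i : ℝ)|).mul_right M).add
        ((hR.hasSum.sub (hite F fun i => |R i|)).mul_right N))
    rw [← Finset.mul_sum]
    by_cases hi : i ∈ F
    · simp only [hi, if_true, sub_self, zero_mul, add_zero]
      rw [mul_assoc]
      exact mul_le_mul_of_nonneg_left (sum_abs_shift_escape_le p a hM ha i) (abs_nonneg _)
    · simp only [hi, if_false, zero_mul, zero_add, sub_zero]
      refine mul_le_mul_of_nonneg_left (Finset.sum_le_sum fun k _ => ?_) (abs_nonneg _)
      split_ifs
      · exact abs_nonneg _
      · exact le_rfl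
  have hconv : Summable fun j : ℤ => |∑ k ∈ s, R (j - k) * a k| := by
    refine Summable.of_nonneg_of_le (fun _ => abs_nonneg _)
      (fun j => Finset.abs_sum_le_sum_abs _ _) (summable_sum fun k _ => ?_)
    simp_rw [abs_mul]
    exact ((Equiv.subRight k).summable_iff.2 hR).mul_right _
  refine (hasSum_le (fun j => ?_) hconv.hasSum
    ((hite s fun j => |∑ k ∈ s, R (j - k) * a k|).add hout)).trans (by gcongr)
  by_cases hj : j ∈ s
  · simp [hj]
  · simp only [hj, if_false, zero_add]
    refine (Finset.abs_sum_le_sum_abs _ _).trans_eq ?_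
    exact Finset.sum_congr rfl fun k _ => abs_mul _ _

/-- Since `c ‖a‖_∞² ≤ c ‖a‖₂² ≤ ⟨a, T a⟩ ≤ ‖a‖_∞ ‖T a‖₁`, one factor `‖a‖_∞` cancels. The constant
is independent of `s`. -/
theorem abs_le_of_toeplitz_form {R : ℤ → ℝ} {c : ℝ} (hc : 0 < c) (s : Finset ℤ) (a : ℤ → ℝ)
    (h : c * ∑ k ∈ s, a k ^ 2 ≤ ∑ j ∈ s, ∑ k ∈ s, a j * a k * R (j - k)) :
    ∀ k ∈ s, |a k| ≤ c⁻¹ * ∑ j ∈ s, |∑ k ∈ s, R (j - k) * a k| := by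
  intro k hk
  obtain ⟨m, hm, hmax⟩ := s.exists_max_image (fun k => |a k|) ⟨k, hk⟩
  refine (hmax k hk).trans ?_
  set Y := ∑ j ∈ s, |∑ k ∈ s, R (j - k) * a k| with hY
  have h1 : c * |a m| ^ 2 ≤ |a m| * Y := by
    have h2 : a m ^ 2 ≤ ∑ k ∈ s, a k ^ 2 :=
      Finset.single_le_sum (f := fun k => a k ^ 2) (fun _ _ => sq_nonneg _) hm
    rw [sq_abs]
    refine (mul_le_mul_of_nonneg_left h2 hc.le).trans (h.trans ?_)
    rw [hY, Finset.mul_sum]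
    refine Finset.sum_le_sum fun j hj => ?_
    have h3 : ∑ k ∈ s, a j * a k * R (j - k) = a j * ∑ k ∈ s, R (j - k) * a k := by
      rw [Finset.mul_sum]
      exact Finset.sum_congr rfl fun k _ => by ring
    rw [h3]
    refine (le_abs_self _).trans ?_
    rw [abs_mul]
    exact mul_le_mul_of_nonneg_right (hmax j hj) (abs_nonneg _)
  have hY0 : 0 ≤ Y := Finset.sum_nonneg fun _ _ => abs_nonneg _
  rw [le_inv_mul_iff₀ hc]
  rcases (abs_nonneg (a m)).eq_or_lt with h0 | h0
  · rw [← h0, mul_zero]; exact hY0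
  · refine le_of_mul_le_mul_left ?_ h0
    nlinarith

/-- Stability of the finite Toeplitz sections in the `ℓ¹` norm. -/
theorem exists_sum_abs_le_toeplitz_int {R : ℤ → ℝ} (hR : Summable fun k => |R k|)
    (hpos : ∀ l ∈ Set.Ioc (-(1 / 2) : ℝ) (1 / 2), 0 < (spectralDensity R l).re) :
    ∃ C : ℝ, 0 < C ∧ ∀ (p : ℕ) (a : ℤ → ℝ), ∑ k ∈ Finset.Icc (1 : ℤ) p, |a k| ≤
      C * ∑ j ∈ Finset.Icc (1 : ℤ) p, |∑ k ∈ Finset.Icc (1 : ℤ) p, R (j - k) * a k| := by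
  obtain ⟨G, hG, hGle⟩ := exists_sum_abs_le_tsum_abs_conv hR (tsum_mul_zpow_ne_zero hpos)
  obtain ⟨c, hc, hcle⟩ := exists_le_toeplitz_form hR hpos
  obtain ⟨F, hF⟩ := (hR.hasSum.eventually_const_lt
    (sub_lt_self (∑' i, |R i|) (by positivity : 0 < (2 * G)⁻¹))).exists
  set D := ∑ i ∈ F, |R i| * |(i : ℝ)| with hD
  have hD0 : 0 ≤ D := Finset.sum_nonneg fun _ _ => by positivity
  -- The choice of `F` makes the long-shift leak at most `N / 2`, so `N ≤ G (Y + D c⁻¹ Y) + N / 2`.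
  refine ⟨2 * (G + G * D * c⁻¹), by positivity, fun p a => ?_⟩
  set s := Finset.Icc (1 : ℤ) p with hs
  set Y := ∑ j ∈ s, |∑ k ∈ s, R (j - k) * a k| with hY
  have hY0 : 0 ≤ Y := Finset.sum_nonneg fun _ _ => abs_nonneg _
  have h1 := (hGle s a).trans (mul_le_mul_of_nonneg_left (tsum_escape_le hR p a
    (by positivity : 0 ≤ c⁻¹ * Y) (abs_le_of_toeplitz_form hc s a (hcle s a)) F) hG.le)
  rw [← hs, ← hY, ← hD] at h1
  set N := ∑ k ∈ s, |a k| with hN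
  have hN0 : 0 ≤ N := Finset.sum_nonneg fun _ _ => abs_nonneg _
  have h2 : G * ((∑' i, |R i| - ∑ i ∈ F, |R i|) * N) ≤ N / 2 := by
    have : (∑' i, |R i| - ∑ i ∈ F, |R i|) * N ≤ (2 * G)⁻¹ * N :=
      mul_le_mul_of_nonneg_right (by linarith) hN0
    refine (mul_le_mul_of_nonneg_left this hG.le).trans_eq ?_
    field_simp
  linarith

theorem sum_Icc_one_natCast {M : Type*} [AddCommMonoid M] (p : ℕ) (f : ℤ → M) :
    ∑ k ∈ Finset.Icc (1 : ℤ) p, f k = ∑ k ∈ Finset.Icc 1 p, f (k : ℕ) := by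
  have h : Finset.Icc (1 : ℤ) p = (Finset.Icc 1 p).image (fun k : ℕ => (k : ℤ)) := by
    ext k
    simp only [Finset.mem_Icc, Finset.mem_image]
    constructor
    · intro hk
      exact ⟨k.toNat, by omega, by omega⟩
    · rintro ⟨m, hm, rfl⟩
      omega
  rw [h, Finset.sum_image fun _ _ _ _ h => Nat.cast_injective h]

theorem exists_sum_abs_le_toeplitz {R : ℤ → ℝ} (hR : Summable fun k => |R k|)
    (hpos : ∀ l ∈ Set.Ioc (-(1 / 2) : ℝ) (1 / 2), 0 < (spectralDensity R l).re) :
    ∃ C : ℝ, 0 < C ∧ ∀ (p : ℕ) (a : ℕ → ℝ), ∑ k ∈ Finset.Icc 1 p, |a k| ≤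
      C * ∑ j ∈ Finset.Icc 1 p, |∑ k ∈ Finset.Icc 1 p, R (j - k) * a k| := by
  obtain ⟨C, hC, h⟩ := exists_sum_abs_le_toeplitz_int hR hpos
  refine ⟨C, hC, fun p a => ?_⟩
  have := h p fun k => a k.toNat
  simpa only [sum_Icc_one_natCast, Int.toNat_natCast] using this

end Stability

variable {Ω : Type*} [MeasurableSpace Ω] {X : ℤ → Ω → ℝ} {P : Measure Ω}

/-! ### Projections in `L²` and the normal equations -/

section Hilbert

theorem IsWSS.inner_toL2 (hX : IsWSS X P) (m n : ℤ) :
    inner ℝ (hX.toL2 m) (hX.toL2 n) = autocov X P (m - n) := by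
  have h := hX.stationary n (m - n)
  rw [add_sub_cancel] at h
  rw [autocov, ← h, L2.inner_def]
  refine integral_congr_ae ?_
  filter_upwards [(hX.memLp m).coeFn_toLp, (hX.memLp n).coeFn_toLp] with ω hm hn
  simp only [IsWSS.toL2, hm, hn]
  simp [mul_comm]

theorem IsWSS.toL2_mem_past (hX : IsWSS X P) {m n : ℤ} (h : m ≤ n) : hX.toL2 m ∈ hX.past n :=
  Submodule.le_topologicalClosure _ (Submodule.subset_span ⟨m, h, rfl⟩)

theorem IsWSS.toL2_mem_finitePast (hX : IsWSS X P) {m n : ℤ} {p : ℕ} (h : n - p + 1 ≤ m)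
    (h' : m ≤ n) : hX.toL2 m ∈ hX.finitePast n p :=
  Submodule.le_topologicalClosure _ (Submodule.subset_span ⟨m, ⟨h, h'⟩, rfl⟩)

theorem mem_orthogonal_closure_span {H : Type*} [NormedAddCommGroup H] [InnerProductSpace ℝ H]
    {S : Set H} {v : H} (h : ∀ x ∈ S, inner ℝ x v = 0) :
    v ∈ (Submodule.span ℝ S).topologicalClosureᗮ := by
  rw [Submodule.orthogonal_closure, Submodule.mem_orthogonal]
  intro u hu
  induction hu using Submodule.span_induction with
  | mem x hx => exact h x hx
  | zero => exact inner_zero_left _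
  | add x y _ _ hx hy => rw [inner_add_left, hx, hy, add_zero]
  | smul a x _ hx => rw [real_inner_smul_left, hx, mul_zero]

theorem IsWSS.norm_toL2 (hX : IsWSS X P) (n : ℤ) : ‖hX.toL2 n‖ = ‖hX.toL2 0‖ := by
  have h : ‖hX.toL2 n‖ ^ 2 = ‖hX.toL2 0‖ ^ 2 := by
    rw [← real_inner_self_eq_norm_sq, ← real_inner_self_eq_norm_sq, hX.inner_toL2, hX.inner_toL2,
      sub_self, sub_self]
  exact (pow_left_inj₀ (norm_nonneg _) (norm_nonneg _) two_ne_zero).1 h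

/-- The variables `X (n - k)` form a sequence which is bounded below. -/
theorem IsWSS.exists_abs_le_norm_sum (hX : IsWSS X P)
    (hR : Summable fun k => |autocov X P k|)
    (hpos : ∀ l ∈ Set.Ioc (-(1 / 2) : ℝ) (1 / 2), 0 < (spectralDensity (autocov X P) l).re) :
    ∃ K : ℝ, 0 < K ∧ ∀ (n : ℤ) (p : ℕ) (a : ℕ → ℝ), ∀ k ∈ Finset.Icc 1 p,
      |a k| ≤ K * ‖∑ k ∈ Finset.Icc 1 p, a k • hX.toL2 (n - k)‖ := by
  obtain ⟨c, hc, h⟩ := exists_le_toeplitz_form hR hpos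
  refine ⟨(√c)⁻¹, by positivity, fun n p a k hk => ?_⟩
  have h1 := h (Finset.Icc 1 p) fun k => a k.toNat
  simp only [sum_Icc_one_natCast, Int.toNat_natCast] at h1
  have h2 : ‖∑ k ∈ Finset.Icc 1 p, a k • hX.toL2 (n - k)‖ ^ 2 =
      ∑ j ∈ Finset.Icc 1 p, ∑ k ∈ Finset.Icc 1 p, a j * a k * autocov X P (j - k) := by
    rw [← real_inner_self_eq_norm_sq, sum_inner]
    simp only [inner_sum, real_inner_smul_left, real_inner_smul_right, hX.inner_toL2]
    rw [Finset.sum_comm]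
    refine Finset.sum_congr rfl fun j _ => Finset.sum_congr rfl fun k _ => ?_
    rw [sub_sub_sub_cancel_left]
    ring
  rw [← h2] at h1
  have h3 : a k ^ 2 ≤ ∑ k ∈ Finset.Icc 1 p, a k ^ 2 :=
    Finset.single_le_sum (f := fun k => a k ^ 2) (fun _ _ => sq_nonneg _) hk
  rw [le_inv_mul_iff₀ (by positivity)]
  refine abs_le_of_sq_le_sq' ?_ (norm_nonneg _) |>.2
  rw [mul_pow, Real.sq_sqrt hc.le, sq_abs]
  exact (mul_le_mul_of_nonneg_left h3 hc.le).trans h1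

theorem IsWSS.normal_eq_of_projection (hX : IsWSS X P) {p : ℕ} {c : ℕ → ℝ} {n : ℤ}
    (h : (hX.finitePast (n - 1) p).starProjection (hX.toL2 n) =
      ∑ k ∈ Finset.Icc 1 p, c k • hX.toL2 (n - k)) :
    ∀ j ∈ Finset.Icc 1 p,
      ∑ k ∈ Finset.Icc 1 p, autocov X P ((j : ℤ) - k) * c k = autocov X P j := by
  intro j hj
  rw [Finset.mem_Icc] at hj
  have hmem : hX.toL2 (n - j) ∈ hX.finitePast (n - 1) p :=
    hX.toL2_mem_finitePast (by omega) (by omega)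
  have h1 := Submodule.starProjection_inner_eq_zero (hX.toL2 n) _ hmem
  rw [h, inner_sub_left, sum_inner, hX.inner_toL2, sub_sub_cancel, sub_eq_zero] at h1
  rw [h1]
  refine Finset.sum_congr rfl fun k _ => ?_
  rw [real_inner_smul_left, hX.inner_toL2, sub_sub_sub_cancel_left, mul_comm]

/-- The normal equations do not involve `n`, so coefficients found at a single time serve at every
time. -/
theorem IsWSS.isFiniteARCoeff_of_normal_eq (hX : IsWSS X P) {p : ℕ} {c : ℕ → ℝ}
    (h : ∀ j ∈ Finset.Icc 1 p,
      ∑ k ∈ Finset.Icc 1 p, autocov X P ((j : ℤ) - k) * c k = autocov X P j) :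
    hX.IsFiniteARCoeff p c := by
  intro n
  refine Submodule.eq_starProjection_of_mem_orthogonal (K := hX.finitePast (n - 1) p) ?_ ?_
  · refine Submodule.sum_mem _ fun k hk => Submodule.smul_mem _ _ ?_
    rw [Finset.mem_Icc] at hk
    exact hX.toL2_mem_finitePast (by omega) (by omega)
  · refine mem_orthogonal_closure_span ?_
    rintro _ ⟨m, ⟨hm, hm'⟩, rfl⟩
    obtain ⟨j, rfl⟩ : ∃ j : ℕ, m = n - j := ⟨(n - m).toNat, by omega⟩
    rw [inner_sub_right, sub_eq_zero, real_inner_comm, hX.inner_toL2, sub_sub_cancel,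
      ← h j (Finset.mem_Icc.2 ⟨by omega, by omega⟩), real_inner_comm, sum_inner]
    refine Finset.sum_congr rfl fun k _ => ?_
    rw [real_inner_smul_left, hX.inner_toL2, sub_sub_sub_cancel_left, mul_comm]

theorem IsWSS.exists_isFiniteARCoeff (hX : IsWSS X P) (p : ℕ) :
    ∃ c : ℕ → ℝ, hX.IsFiniteARCoeff p c := by
  have himg : hX.toL2 '' {m : ℤ | (0 : ℤ) - 1 - p + 1 ≤ m ∧ m ≤ 0 - 1} =
      (fun k : ℕ => hX.toL2 (0 - k)) '' (Finset.Icc 1 p : Finset ℕ) := by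
    ext v
    constructor
    · rintro ⟨m, ⟨h, h'⟩, rfl⟩
      refine ⟨(-m).toNat, ?_, ?_⟩
      · rw [Finset.mem_coe, Finset.mem_Icc]; omega
      · exact congrArg hX.toL2 (by omega)
    · rintro ⟨k, hk, rfl⟩
      rw [Finset.mem_coe, Finset.mem_Icc] at hk
      exact ⟨0 - k, ⟨by omega, by omega⟩, rfl⟩
  have hspan : hX.finitePast (0 - 1) p =
      Submodule.span ℝ ((fun k : ℕ => hX.toL2 (0 - k)) '' (Finset.Icc 1 p : Finset ℕ)) := by
    have : FiniteDimensional ℝ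
        (Submodule.span ℝ ((fun k : ℕ => hX.toL2 (0 - k)) '' (Finset.Icc 1 p : Finset ℕ))) :=
      FiniteDimensional.span_of_finite ℝ ((Finset.finite_toSet _).image _)
    rw [IsWSS.finitePast, himg]
    exact (Submodule.closed_of_finiteDimensional _).submodule_topologicalClosure_eq
  have hmem := Submodule.starProjection_apply_mem (hX.finitePast (0 - 1) p) (hX.toL2 0)
  obtain ⟨c, hc⟩ := (Submodule.mem_span_image_finset_iff_exists_fun' ℝ).1 (hspan.le hmem)
  refine ⟨c, hX.isFiniteARCoeff_of_normal_eq (hX.normal_eq_of_projection (n := 0) hc.symm)⟩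

theorem sum_Icc_one_eq_sum_range {M : Type*} [AddCommMonoid M] {f : ℕ → M} (h0 : f 0 = 0)
    (N : ℕ) : ∑ k ∈ Finset.Icc 1 N, f k = ∑ k ∈ Finset.range (N + 1), f k := by
  refine Finset.sum_subset (fun k hk => ?_) fun k hk hk' => ?_
  · rw [Finset.mem_Icc] at hk; rw [Finset.mem_range]; omega
  · rw [Finset.mem_range] at hk
    rw [Finset.mem_Icc] at hk'
    rw [show k = 0 by omega, h0]

/-- All `X n` have the same norm, so summability of `b` gives norm convergence, and continuity of
the inner product turns the equations into orthogonality to the past. -/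
theorem IsWSS.isARCoeff_of_normal_eq (hX : IsWSS X P) {b : ℕ → ℝ} (h0 : b 0 = 0)
    (hb : Summable fun k => |b k|)
    (h : ∀ j : ℕ, 1 ≤ j → HasSum (fun k : ℕ => autocov X P ((j : ℤ) - k) * b k) (autocov X P j)) :
    hX.IsARCoeff b := by
  intro n
  have hs : Summable fun k : ℕ => b k • hX.toL2 (n - k) := by
    refine Summable.of_norm_bounded (hb.mul_right ‖hX.toL2 0‖) fun k => ?_
    rw [norm_smul, hX.norm_toL2, Real.norm_eq_abs]
  have hmem : ∀ N : ℕ, ∑ k ∈ Finset.Icc 1 N, b k • hX.toL2 (n - k) ∈ hX.past (n - 1) := fun N =>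
    Submodule.sum_mem _ fun k hk => Submodule.smul_mem _ _ (by
      rw [Finset.mem_Icc] at hk
      exact hX.toL2_mem_past (by omega))
  have ht : Tendsto (fun N : ℕ => ∑ k ∈ Finset.Icc 1 N, b k • hX.toL2 (n - k)) atTop
      (𝓝 (∑' k : ℕ, b k • hX.toL2 (n - k))) := by
    have := hs.hasSum.tendsto_sum_nat.comp (tendsto_add_atTop_nat 1)
    refine this.congr fun N => ?_
    rw [sum_Icc_one_eq_sum_range (by rw [h0, zero_smul])]
    rfl
  convert ht using 2
  refine Submodule.eq_starProjection_of_mem_orthogonal (K := hX.past (n - 1)) ?_ ?_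
  · exact (Submodule.isClosed_topologicalClosure _).mem_of_tendsto ht (Eventually.of_forall hmem)
  · refine mem_orthogonal_closure_span ?_
    rintro _ ⟨m, hm, rfl⟩
    rw [Set.mem_ofPred_eq] at hm
    obtain ⟨j, rfl⟩ : ∃ j : ℕ, m = n - j := ⟨(n - m).toNat, by omega⟩
    have h1 := hs.hasSum.mapL (innerSL ℝ (hX.toL2 (n - j)))
    have h2 := h j (by omega)
    rw [inner_sub_right, sub_eq_zero, real_inner_comm, hX.inner_toL2, sub_sub_cancel, ← h2.tsum_eq,
      ← innerSL_apply_apply ℝ, ← h1.tsum_eq]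
    refine tsum_congr fun k => ?_
    rw [innerSL_apply_apply, real_inner_smul_right, real_inner_comm, hX.inner_toL2,
      sub_sub_sub_cancel_left, mul_comm]

theorem IsWSS.finitePast_mono (hX : IsWSS X P) (n : ℤ) : Monotone (hX.finitePast n) := by
  intro p q hpq
  refine Submodule.topologicalClosure_mono (Submodule.span_mono (Set.image_mono ?_))
  rintro m ⟨h, h'⟩
  exact ⟨by omega, h'⟩

end Hilbert

/-! ### The infinite-order coefficients and Baxter's inequality -/

section Convergence

/-- Finite-order coefficients extended by zero. -/
theorem IsWSS.exists_isFiniteARCoeff_support (hX : IsWSS X P) (p : ℕ) :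
    ∃ c : ℕ → ℝ, hX.IsFiniteARCoeff p c ∧ ∀ k ∉ Finset.Icc 1 p, c k = 0 := by
  obtain ⟨c, hc⟩ := hX.exists_isFiniteARCoeff p
  refine ⟨fun k => if k ∈ Finset.Icc 1 p then c k else 0, fun n => ?_, fun k hk => if_neg hk⟩
  rw [hc n]
  exact Finset.sum_congr rfl fun k hk => by simp only [hk, if_true]

theorem sum_Icc_eq_of_support {M : Type*} [AddCommMonoid M] {p q : ℕ} (hpq : p ≤ q) {f : ℕ → M}
    (hf : ∀ k ∉ Finset.Icc 1 p, f k = 0) :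
    ∑ k ∈ Finset.Icc 1 p, f k = ∑ k ∈ Finset.Icc 1 q, f k :=
  Finset.sum_subset (Finset.Icc_subset_Icc_right hpq) fun k _ hk => hf k hk

/-- The finite-order coefficients converge uniformly. -/
theorem IsWSS.exists_uniform_limit (hX : IsWSS X P)
    (hR : Summable fun k => |autocov X P k|)
    (hpos : ∀ l ∈ Set.Ioc (-(1 / 2) : ℝ) (1 / 2), 0 < (spectralDensity (autocov X P) l).re)
    {c : ℕ → ℕ → ℝ} (hc : ∀ p, hX.IsFiniteARCoeff p (c p))
    (hc0 : ∀ p, ∀ k ∉ Finset.Icc 1 p, c p k = 0) :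
    ∃ (b : ℕ → ℝ) (e : ℕ → ℝ), Tendsto e atTop (𝓝 0) ∧ ∀ p k, |c p k - b k| ≤ e p := by
  obtain ⟨K, hK, hKle⟩ := hX.exists_abs_le_norm_sum hR hpos
  set π : ℕ → Lp ℝ 2 P := fun p => (hX.finitePast (0 - 1) p).starProjection (hX.toL2 0) with hπ
  -- Only convergence is used; the limit need not be identified.
  obtain ⟨v, hv⟩ : ∃ v, Tendsto π atTop (𝓝 v) :=
    ⟨_, Submodule.starProjection_tendsto_closure_iSup (hX.finitePast (0 - 1))
      (hX.finitePast_mono _) (hX.toL2 0)⟩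
  have hπeq : ∀ p q, p ≤ q → π p = ∑ k ∈ Finset.Icc 1 q, c p k • hX.toL2 (0 - k) :=
    fun p q hpq => by
      rw [← sum_Icc_eq_of_support hpq fun k hk => by rw [hc0 p k hk, zero_smul]]
      exact hc p 0
  -- Padding by zeros writes both projections over the same variables, whose combinations dominate
  -- each of their coefficients.
  have hdist : ∀ p q k, |c p k - c q k| ≤ K * ‖π p - π q‖ := fun p q k => by
    by_cases hk : k ∈ Finset.Icc 1 (max p q)
    · rw [hπeq p _ (le_max_left p q), hπeq q _ (le_max_right p q), ← Finset.sum_sub_distrib]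
      simp only [← sub_smul]
      exact hKle 0 _ (fun k => c p k - c q k) k hk
    · rw [hc0 p, hc0 q, sub_zero, abs_zero]
      · positivity
      · exact fun h => hk (Finset.Icc_subset_Icc_right (le_max_right p q) h)
      · exact fun h => hk (Finset.Icc_subset_Icc_right (le_max_left p q) h)
  have hcauchy : ∀ k, CauchySeq fun p => c p k := fun k => by
    refine Metric.cauchySeq_iff.2 fun ε hε => ?_
    obtain ⟨N, hN⟩ := Metric.cauchySeq_iff.1 hv.cauchySeq (ε / K) (by positivity)
    refine ⟨N, fun m hm n hn => ?_⟩
    have h := hN m hm n hn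
    rw [lt_div_iff₀' hK, dist_eq_norm] at h
    rw [Real.dist_eq]
    exact (hdist m n k).trans_lt h
  choose b hb using fun k => cauchySeq_tendsto_of_complete (hcauchy k)
  refine ⟨b, fun p => K * ‖π p - v‖, ?_, fun p k => ?_⟩
  · have h := ((tendsto_const_nhds (x := K)).mul (hv.sub_const v).norm)
    rwa [sub_self, norm_zero, mul_zero] at h
  · exact le_of_tendsto_of_tendsto (tendsto_const_nhds.sub (hb k)).abs
      (((tendsto_const_nhds.sub hv).norm).const_mul K)
      (Eventually.of_forall fun q => hdist p q k)

theorem summable_abs_comp_sub {R : ℤ → ℝ} (hR : Summable fun k => |R k|) (j : ℤ) :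
    Summable fun k : ℕ => |R (j - k)| :=
  hR.comp_injective (i := fun k : ℕ => j - (k : ℤ)) fun a b h => by
    simpa using h

theorem sum_abs_comp_sub_le {R : ℤ → ℝ} (hR : Summable fun k => |R k|) (s : Finset ℕ) (k : ℤ) :
    ∑ j ∈ s, |R (j - k)| ≤ ∑' i, |R i| := by
  have hinj : Function.Injective fun j : ℕ => (j : ℤ) - k := fun a b h => by simpa using h
  exact ((hR.comp_injective hinj).sum_le_tsum s fun _ _ => abs_nonneg _).trans
    (tsum_comp_le_tsum_of_inj hR (fun _ => abs_nonneg _) hinj)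

/-- Absolutely summable solutions of the infinite normal equations exist. -/
theorem IsWSS.exists_normal_eq (hX : IsWSS X P)
    (hR : Summable fun k => |autocov X P k|)
    (hpos : ∀ l ∈ Set.Ioc (-(1 / 2) : ℝ) (1 / 2), 0 < (spectralDensity (autocov X P) l).re) :
    ∃ b : ℕ → ℝ, b 0 = 0 ∧ (Summable fun k => |b k|) ∧ ∀ j : ℕ, 1 ≤ j →
      HasSum (fun k : ℕ => autocov X P ((j : ℤ) - k) * b k) (autocov X P j) := by
  choose c hc hc0 using hX.exists_isFiniteARCoeff_support
  obtain ⟨b, e, he, hbe⟩ := hX.exists_uniform_limit hR hpos hc hc0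
  obtain ⟨C, hC, hCle⟩ := exists_sum_abs_le_toeplitz hR hpos
  set R := autocov X P with hRdef
  have hlim : ∀ k, Tendsto (fun p => c p k) atTop (𝓝 (b k)) := fun k =>
    tendsto_iff_norm_sub_tendsto_zero.2
      (squeeze_zero (fun _ => norm_nonneg _) (fun p => hbe p k) he)
  have hb0 : b 0 = 0 := tendsto_nhds_unique (hlim 0)
    (tendsto_const_nhds.congr fun p => (hc0 p 0 (by simp)).symm)
  have hnormal : ∀ p : ℕ, ∀ j ∈ Finset.Icc 1 p,
      ∑ k ∈ Finset.Icc 1 p, R ((j : ℤ) - k) * c p k = R j := fun p => hX.normal_eq_of_projection (hc p 0)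
  -- Stability applied to the normal equations, whose right-hand side has `ℓ¹` norm at most that of
  -- `R`.
  have hcbound : ∀ p, ∑ k ∈ Finset.Icc 1 p, |c p k| ≤ C * ∑' i, |R i| := fun p => by
    refine (hCle p (c p)).trans (mul_le_mul_of_nonneg_left ?_ hC.le)
    rw [Finset.sum_congr rfl fun j hj => congrArg abs (hnormal p j hj)]
    simpa using sum_abs_comp_sub_le hR (Finset.Icc 1 p) 0
  have hbs : Summable fun k => |b k| := by
    refine summable_of_sum_range_le (fun _ => abs_nonneg _) (c := C * ∑' i, |R i|) fun N => ?_
    refine le_of_tendsto (tendsto_finsetSum _ fun k _ => (hlim k).abs)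
      (Eventually.of_forall fun p => le_trans ?_ (hcbound p))
    have h : HasSum (fun k => |c p k|) (∑ k ∈ Finset.Icc 1 p, |c p k|) :=
      hasSum_sum_of_ne_finset_zero fun k hk => by rw [hc0 p k hk, abs_zero]
    exact sum_le_hasSum _ (fun _ _ => abs_nonneg _) h
  refine ⟨b, hb0, hbs, fun j hj => ?_⟩
  have hRj := summable_abs_comp_sub hR j
  have hRb : Summable fun k : ℕ => R ((j : ℤ) - k) * b k := by
    refine Summable.of_norm_bounded (hbs.mul_left (∑' i, |R i|)) fun k => ?_
    rw [norm_mul]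
    exact mul_le_mul_of_nonneg_right (hR.le_tsum _ fun _ _ => abs_nonneg _) (abs_nonneg _)
  have hRc : ∀ p, j ≤ p → HasSum (fun k : ℕ => R ((j : ℤ) - k) * c p k) (R j) := fun p hp => by
    rw [← hnormal p j (Finset.mem_Icc.2 ⟨hj, hp⟩)]
    exact hasSum_sum_of_ne_finset_zero fun k hk => by rw [hc0 p k hk, mul_zero]
  -- Each row of `R` is summable, so uniform convergence of the coefficients suffices to pass to the
  -- limit.
  have hle : ∀ p, j ≤ p → |R j - ∑' k : ℕ, R ((j : ℤ) - k) * b k| ≤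
      (∑' k : ℕ, |R ((j : ℤ) - k)|) * e p := fun p hp => by
    have h1 := (hRc p hp).sub hRb.hasSum
    rw [← h1.tsum_eq, ← Real.norm_eq_abs]
    refine tsum_of_norm_bounded (hRj.hasSum.mul_right (e p)) fun k => ?_
    rw [← mul_sub, norm_mul]
    exact mul_le_mul_of_nonneg_left (hbe p k) (abs_nonneg _)
  have h0 : |R j - ∑' k : ℕ, R ((j : ℤ) - k) * b k| ≤ 0 := by
    have h := he.const_mul (∑' k : ℕ, |R ((j : ℤ) - k)|)
    rw [mul_zero] at h
    exact ge_of_tendsto h ((eventually_ge_atTop j).mono hle)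
  rw [sub_eq_zero.1 (abs_eq_zero.1 (h0.antisymm (abs_nonneg _)))]
  exact hRb.hasSum

/-- Needed because `IsARCoeff` does not include summability, which is known only for the constructed
solution. Differences of partial sums tend to zero and dominate each coefficient. -/
theorem IsWSS.IsARCoeff.unique {hX : IsWSS X P}
    (hR : Summable fun k => |autocov X P k|)
    (hpos : ∀ l ∈ Set.Ioc (-(1 / 2) : ℝ) (1 / 2), 0 < (spectralDensity (autocov X P) l).re)
    {b b' : ℕ → ℝ} (hb : hX.IsARCoeff b) (hb' : hX.IsARCoeff b') {k : ℕ} (hk : 1 ≤ k) :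
    b k = b' k := by
  obtain ⟨K, hK, hKle⟩ := hX.exists_abs_le_norm_sum hR hpos
  have h1 := (((hb 0).sub (hb' 0)).norm).const_mul K
  rw [sub_self, norm_zero, mul_zero] at h1
  have h2 : |b k - b' k| ≤ 0 := by
    refine ge_of_tendsto h1 ((eventually_ge_atTop k).mono fun N hN => ?_)
    rw [← Finset.sum_sub_distrib]
    simp only [← sub_smul]
    exact hKle 0 N (fun k => b k - b' k) k (Finset.mem_Icc.2 ⟨hk, hN⟩)
  exact sub_eq_zero.1 (abs_eq_zero.1 (h2.antisymm (abs_nonneg _)))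

/-- Baxter's inequality: the error of the finite-order coefficients is controlled by the tail of
the infinite-order ones. -/
theorem sum_abs_sub_le_tail {R : ℤ → ℝ} (hR : Summable fun k => |R k|) {C : ℝ} (hC : 0 ≤ C)
    {p : ℕ} (hCle : ∀ a : ℕ → ℝ, ∑ k ∈ Finset.Icc 1 p, |a k| ≤
      C * ∑ j ∈ Finset.Icc 1 p, |∑ k ∈ Finset.Icc 1 p, R (j - k) * a k|)
    {b c : ℕ → ℝ} (hb0 : b 0 = 0) (hb : Summable fun k => |b k|)
    (hbn : ∀ j : ℕ, 1 ≤ j → HasSum (fun k : ℕ => R ((j : ℤ) - k) * b k) (R j))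
    (hcn : ∀ j ∈ Finset.Icc 1 p, ∑ k ∈ Finset.Icc 1 p, R ((j : ℤ) - k) * c k = R j) :
    ∑ k ∈ Finset.Icc 1 p, |c k - b k| ≤
      C * ((∑' i, |R i|) * ∑' k : ℕ, |b (k + (p + 1))|) := by
  refine (hCle fun k => c k - b k).trans (mul_le_mul_of_nonneg_left ?_ hC)
  have hsR : ∀ j : ℤ, Summable fun k : ℕ => |R (j - (k + (p + 1) : ℕ))| * |b (k + (p + 1))| :=
    fun j => by
      refine Summable.of_nonneg_of_le (fun _ => by positivity) (fun k => ?_)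
        (((summable_nat_add_iff (p + 1)).2 hb).mul_left (∑' i, |R i|))
      exact mul_le_mul_of_nonneg_right (hR.le_tsum _ fun _ _ => abs_nonneg _) (abs_nonneg _)
  -- Row `j` of the section applied to `c - b` is exactly the tail `∑_{k>p} R (j - k) b k`.
  have h1 : ∀ j ∈ Finset.Icc 1 p, |∑ k ∈ Finset.Icc 1 p, R ((j : ℤ) - k) * (c k - b k)| ≤
      ∑' k : ℕ, |R (j - (k + (p + 1) : ℕ))| * |b (k + (p + 1))| := fun j hj => by
    have h2 := hbn j (Finset.mem_Icc.1 hj).1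
    have h3 := h2.summable.sum_add_tsum_nat_add (p + 1)
    rw [h2.tsum_eq, ← hcn j hj, ← sum_Icc_one_eq_sum_range (by rw [hb0, mul_zero])] at h3
    simp only [mul_sub, Finset.sum_sub_distrib]
    rw [← h3, add_sub_cancel_left, ← Real.norm_eq_abs]
    exact tsum_of_norm_bounded (hsR j).hasSum fun k => (norm_mul _ _).le
  refine (Finset.sum_le_sum h1).trans ?_
  rw [← Summable.tsum_finsetSum fun (j : ℕ) _ => hsR j, ← tsum_mul_left]
  refine Summable.tsum_le_tsum (fun k => ?_) (summable_sum fun (j : ℕ) _ => hsR j)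
    (((summable_nat_add_iff (p + 1)).2 hb).mul_left _)
  rw [← Finset.sum_mul]
  exact mul_le_mul_of_nonneg_right (sum_abs_comp_sub_le hR _ _) (abs_nonneg _)

end Convergence

end ARApprox

end

theorem mainTheorem4 {Ω : Type*} [MeasurableSpace Ω] (P : Measure Ω) [IsProbabilityMeasure P]
    (X : ℤ → Ω → ℝ) (hX : ARApprox.IsWSS X P)
    (hsum : Summable (fun k : ℤ => |ARApprox.autocov X P k|))
    (hpos : ∀ l ∈ Set.Ioc (-(1 / 2) : ℝ) (1 / 2),
      0 < (ARApprox.spectralDensity (ARApprox.autocov X P) l).re) :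
    (∃ b : ℕ → ℝ, hX.IsARCoeff b) ∧
    (∀ p : ℕ, 1 ≤ p → ∃ c : ℕ → ℝ, hX.IsFiniteARCoeff p c) ∧
    ∀ (b : ℕ → ℝ) (bp : ℕ → ℕ → ℝ), hX.IsARCoeff b →
      (∀ p : ℕ, 1 ≤ p → hX.IsFiniteARCoeff p (bp p)) →
      Tendsto (fun p : ℕ => ∑ k ∈ Finset.Icc 1 p, |bp p k - b k|) atTop (𝓝 0) := by
  obtain ⟨b', hb0, hbs, hbn⟩ := hX.exists_normal_eq hsum hpos
  have hb' := hX.isARCoeff_of_normal_eq hb0 hbs hbn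
  refine ⟨⟨b', hb'⟩, fun p _ => hX.exists_isFiniteARCoeff p, fun b bp hb hbp => ?_⟩
  obtain ⟨C, hC, hCle⟩ := ARApprox.exists_sum_abs_le_toeplitz hsum hpos
  have htail : Tendsto (fun p : ℕ => C * ((∑' i, |ARApprox.autocov X P i|) *
      ∑' k : ℕ, |b' (k + (p + 1))|)) atTop (𝓝 0) := by
    have h := (((tendsto_sum_nat_add fun k => |b' k|).comp (tendsto_add_atTop_nat 1)).const_mul
      (∑' i, |ARApprox.autocov X P i|)).const_mul C
    rwa [mul_zero, mul_zero] at h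
  -- The bound is only eventual: nothing is assumed about `bp 0`.
  refine squeeze_zero' (Eventually.of_forall fun p => Finset.sum_nonneg fun _ _ => abs_nonneg _)
    ((eventually_ge_atTop 1).mono fun p hp => ?_) htail
  rw [Finset.sum_congr rfl fun k hk => by
    rw [hb.unique hsum hpos hb' (Finset.mem_Icc.1 hk).1]]
  exact ARApprox.sum_abs_sub_le_tail hsum hC.le (hCle p) hb0 hbs hbn
    (hX.normal_eq_of_projection (hbp p hp 0))
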